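/- Model. Let $[m]$ be a set of $m$ labelled elements. A randomized parallel algorithm on $m$ elements is a finite-depth probabilistic parallel decision tree: a randomization node chooses one of finitely many branches uniformly at random; a query node (one \emph{round}) submits finitely many subsets $B_1,\dots,B_q\subseteq[m]$ simultaneously to an independence oracle of an unknown matroid on $[m]$ and branches according to the $q$ answers (independent or not); a leaf outputs a subset of $[m]$. For a finite multigraph $G$ (loops and parallel edges allowed), the cographic matroid of $G$ is the matroid on the edge set of $G$ in which a set of edges is independent if and only if its complement contains a spanning forest of $G$, that is, an acyclic set of edges with the same connected components as $G$; a matroid is cographic if it is the cographic matroid of some finite multigraph. Statement. There is a constant $C$ such that for every $c\in\mathbb{N}$ there are $k\in\mathbb{N}$ and a family of randomized parallel algorithms $(A_m)_{m\ge 2}$, with $A_m$ an algorithm on $m$ elements, such that for every $m\ge 2$: on every computation path $A_m$ uses at most $C\log m$ rounds and at most $m^k$ independence queries in each round; and for every cographic matroid $M$ on the ground set $[m]$, $A_m$ run with the independence oracle of $M$ outputs a basis of $M$ with probability at least $1-m^{-c}$. In short: a basis of any cographic matroid on $m$ elements can be found with high probability in $O(\log m)$ rounds using $\mathrm{poly}(m)$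 independence queries per round. -/

import Mathlib

/-! ### Cographic matroids of finite multigraphs -/

namespace Graph

variable {V α : Type*}

/-- `C` is the edge set of a cycle of the multigraph `G`: there are distinct vertices
`v 0, …, v n` and distinct edges `e 0, …, e n` (`n ≥ 0`) such that `e i` joins `v i` to `v (i + 1)`,
indices being cyclic, i.e. modulo `n + 1`. Thus a loop is a cycle of length one, and two parallel
edges form a cycle of length two. -/
def IsCycleEdgeSet (G : Graph V α) (C : Set α) : Prop :=
  ∃ (n : ℕ) (v : Fin (n + 1) → V) (e : Fin (n + 1) → α),
    Function.Injective v ∧ Function.Injective e ∧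
      (∀ i, G.IsLink (e i) (v i) (v (i + 1))) ∧ C = Set.range e

/-- `y` can be reached from `x` along edges of `G` that belong to `F`. -/
def ReachableIn (G : Graph V α) (F : Set α) (x y : V) : Prop :=
  Relation.ReflTransGen (fun a b => ∃ e ∈ F, G.IsLink e a b) x y

/-- `F` is (the edge set of) a spanning forest of `G`: a set of edges of `G` that contains no cycle
and has the same connected components as `G`. -/
structure IsSpanningForest (G : Graph V α) (F : Set α) : Prop where
  subset_edgeSet : F ⊆ G.edgeSet
  acyclic : ∀ C, G.IsCycleEdgeSet C → ¬ C ⊆ F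
  reachable : ∀ x y, G.ReachableIn G.edgeSet x y → G.ReachableIn F x y

/-- `M` is the cographic matroid of `G`: its ground set is the set of edges of `G`, and a set of
edges is independent iff its complement contains a spanning forest of `G`. -/
def IsCographicMatroid (G : Graph V α) (M : Matroid α) : Prop :=
  M.E = G.edgeSet ∧
    ∀ S ⊆ G.edgeSet, M.Indep S ↔ ∃ F, G.IsSpanningForest F ∧ F ⊆ G.edgeSet \ S

end Graph

/-- A matroid is cographic if it is the cographic matroid of some multigraph with finitely many
vertices (loops and parallel edges are allowed). -/
def Matroid.IsCographic {α : Type*} (M : Matroid α) : Prop :=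
  ∃ (V : Type) (G : Graph V α), G.vertexSet.Finite ∧ G.IsCographicMatroid M

/-! ### Randomized parallel algorithms with access to an oracle on subsets of `{0, …, m - 1}` -/

/-- A probabilistic parallel decision tree on `m` elements.
* `leaf B`: stop and output the set `B`.
* `random b next`: pick one of the `b + 1` branches uniformly at random.
* `query q B next`: one round. The `q` sets `B 0, …, B (q - 1)` are submitted to the oracle
  simultaneously, and the computation continues along the branch given by the `q` answers. -/
inductive ParallelDecisionTree (m : ℕ) : Type
  | leaf (B : Finset (Fin m)) : ParallelDecisionTree m
  | random (b : ℕ) (next : Fin (b + 1) → ParallelDecisionTree m) : ParallelDecisionTree m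
  | query (q : ℕ) (B : Fin q → Finset (Fin m))
      (next : (Fin q → Bool) → ParallelDecisionTree m) : ParallelDecisionTree m

namespace ParallelDecisionTree

variable {m : ℕ}

/-- The largest number of rounds (query nodes) on a path from the root to a leaf. -/
def rounds : ParallelDecisionTree m → ℕ
  | leaf _ => 0
  | random _ next => Finset.univ.sup fun i => (next i).rounds
  | query _ _ next => 1 + Finset.univ.sup fun a => (next a).rounds

/-- The largest number of queries made in a single round, anywhere in the tree. -/
def queriesPerRound : ParallelDecisionTree m → ℕ
  | leaf _ => 0
  | random _ next => Finset.univ.sup fun i => (next i).queriesPerRound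
  | query q _ next => max q (Finset.univ.sup fun a => (next a).queriesPerRound)

/-- The distribution of the output when the queries are answered by the oracle `O`. -/
noncomputable def outputDist (O : Finset (Fin m) → Bool) :
    ParallelDecisionTree m → PMF (Finset (Fin m))
  | leaf B => PMF.pure B
  | random b next => (PMF.uniformOfFintype (Fin (b + 1))).bind fun i => (next i).outputDist O
  | query _ B next => (next fun j => O (B j)).outputDist O

end ParallelDecisionTree

open Classical in
/-- The independence oracle of `M`: on the query `S` it answers whether `S` is independent. -/
noncomputable def Matroid.indepOracle {m : ℕ} (M : Matroid (Fin m)) (S : Finset (Fin m)) : Bool :=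
  decide (M.Indep (S : Set (Fin m)))

/-- The probability that the algorithm `T`, run with the independence oracle of `M` and with no
other access to `M`, outputs a basis of `M`. -/
noncomputable def ParallelDecisionTree.basisProb {m : ℕ} (T : ParallelDecisionTree m)
    (M : Matroid (Fin m)) : ℝ :=
  ((T.outputDist M.indepOracle).toOuterMeasure {B | M.IsBase (B : Set (Fin m))}).toReal

/-! A set is dependent in a cographic matroid exactly when it contains a nonempty cut, so with `X`
the cut space over `ZMod 2`, a set `S` is independent iff no nonzero vector of `X` is supported in
`S`. The algorithm keeps a spanning set `R`, initially everything, and each round raises the least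
size of a nonempty cut inside `R` by the factor 3/2. Once this size exceeds `m`, `R` is independent,
hence a basis; this takes O(log m) rounds.

For one round, let `γ` be the current lower bound on cut sizes. Suppose a test set contains a cut
`C` of `R` but no other nonempty cut of `R`. Querying its prefixes within `R` shows that the largest
element of `C` depends on smaller ones, so this element is deleted and `C` is destroyed. Deleting
all such elements simultaneously keeps `R` spanning, since each lies in the closure of smaller
elements of `R` (`spanning_survivors`, `hasGirthAtLeast_survivors`).

It remains to isolate all cuts of size at most 3γ/2 with polynomially many test sets. The cuts
inside `R` form the cut space of the graph with the edges outside `R` contracted; it is spanned by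
stars, and each edge lies in at most two of them. This alone gives a Karger-type bound: at most
(2m)^a cuts have size at most aγ/2 (`card_lightVectors_le`). A random set of density m^(-56/γ)
therefore isolates a given short cut with probability at least m^(-85)
(`le_sum_isolatingSets_samplingProb`). There are at most 2^(m²+m) pairs of a space and a vector, so
some fixed family of m^88 sets works for all of them (`exists_isolating_family`). The family depends
only on `m` and `γ`, not on the matroid or on `R`, so the algorithm needs no randomness. -/

/-! ### Binary spaces restricted to a set of coordinates -/

namespace Submodule

variable {α : Type*}

/-- The vectors of `X` that vanish outside `R`. -/
def supportedIn (X : Submodule (ZMod 2) (α → ZMod 2)) (R : Set α) :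
    Submodule (ZMod 2) (α → ZMod 2) where
  carrier := {D | D ∈ X ∧ ∀ e ∉ R, D e = 0}
  add_mem' := fun ha hb => ⟨X.add_mem ha.1 hb.1, fun e he => by simp [ha.2 e he, hb.2 e he]⟩
  zero_mem' := ⟨X.zero_mem, fun _ _ => rfl⟩
  smul_mem' := fun c _ hx => ⟨X.smul_mem c hx.1, fun e he => by simp [hx.2 e he]⟩

theorem mem_supportedIn {X : Submodule (ZMod 2) (α → ZMod 2)} {R : Set α} {D : α → ZMod 2} :
    D ∈ X.supportedIn R ↔ D ∈ X ∧ ∀ e ∉ R, D e = 0 := Iff.rfl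

theorem supportedIn_supportedIn (X : Submodule (ZMod 2) (α → ZMod 2)) (R S : Set α) :
    (X.supportedIn R).supportedIn S = X.supportedIn (R ∩ S) := by
  ext D
  simp only [mem_supportedIn, Set.mem_inter_iff]
  constructor
  · rintro ⟨⟨h1, h2⟩, h3⟩
    refine ⟨h1, fun e he => ?_⟩
    by_cases h : e ∈ R
    · exact h3 e fun h' => he ⟨h, h'⟩
    · exact h2 e h
  · rintro ⟨h1, h2⟩
    exact ⟨⟨h1, fun e he => h2 e fun h => he h.1⟩, fun e he => h2 e fun h => he h.2⟩

theorem supportedIn_mono {X : Submodule (ZMod 2) (α → ZMod 2)} {R S : Set α} (h : R ⊆ S) :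
    X.supportedIn R ≤ X.supportedIn S :=
  fun _ hD => ⟨hD.1, fun e he => hD.2 e fun h' => he (h h')⟩

/-- `X` is spanned by finitely many vectors such that each coordinate is nonzero in at most two
of them. -/
def TwoCovered (X : Submodule (ZMod 2) (α → ZMod 2)) : Prop :=
  ∃ 𝓑 : Finset (α → ZMod 2), span (ZMod 2) (𝓑 : Set (α → ZMod 2)) = X ∧
    ∀ e, {B ∈ 𝓑 | B e ≠ 0}.card ≤ 2

/-- Every subspace of `X` cut out by the vanishing of coordinates is two-covered. -/
def HereditarilyTwoCovered (X : Submodule (ZMod 2) (α → ZMod 2)) : Prop :=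
  ∀ R : Set α, (X.supportedIn R).TwoCovered

theorem HereditarilyTwoCovered.supportedIn {X : Submodule (ZMod 2) (α → ZMod 2)}
    (hX : X.HereditarilyTwoCovered) (R : Set α) : (X.supportedIn R).HereditarilyTwoCovered := by
  intro S
  rw [supportedIn_supportedIn]
  exact hX _

end Submodule

/-! ### The cut space and its stars -/

section CutSpace

variable {V α : Type*}

/-- The coboundary map modulo two of the multigraph in which the edge `e` joins `a e` to `b e`. -/
def coboundary (a b : α → V) : (V → ZMod 2) →ₗ[ZMod 2] (α → ZMod 2) :=
  LinearMap.funLeft (ZMod 2) (ZMod 2) a + LinearMap.funLeft (ZMod 2) (ZMod 2) b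

theorem coboundary_apply (a b : α → V) (x : V → ZMod 2) (e : α) :
    coboundary a b x e = x (a e) + x (b e) := rfl

theorem ZMod.two_add_eq_zero_iff (x y : ZMod 2) : x + y = 0 ↔ x = y := by
  revert x y; decide

/-- The cut space of the multigraph in which the edge `e` joins `a e` to `b e`. -/
def cutSpace (a b : α → V) : Submodule (ZMod 2) (α → ZMod 2) :=
  LinearMap.range (coboundary a b)

-- Cuts inside `R` are the cuts of the graph with all edges outside `R` contracted. The stars of the
-- contracted vertices span them, and an edge lies only in the stars of its two ends.
open Classical in
theorem hereditarilyTwoCovered_cutSpace [Finite α] (a b : α → V) :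
    (cutSpace a b).HereditarilyTwoCovered := by
  intro R
  have := Fintype.ofFinite α
  let r : Setoid V := Relation.EqvGen.setoid fun u v => ∃ e ∉ R, a e = u ∧ b e = v
  let p : V → Quotient r := Quotient.mk r
  have hp : ∀ e ∉ R, p (a e) = p (b e) := fun e he =>
    Quotient.sound (Relation.EqvGen.rel _ _ ⟨e, he, rfl, rfl⟩)
  let star : Quotient r → α → ZMod 2 := fun q => coboundary a b fun v => if p v = q then 1 else 0
  -- The vertex set may be infinite; only classes containing an end of an edge have a nonzero star.
  let T : Finset (Quotient r) :=
    (Finset.univ.image fun e => p (a e)) ∪ Finset.univ.image fun e => p (b e)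
  have hstar : ∀ q, star q ∈ (cutSpace a b).supportedIn R := fun q =>
    ⟨⟨_, rfl⟩, fun e he => by
      simp only [star, coboundary_apply, hp e he]
      exact (ZMod.two_add_eq_zero_iff _ _).2 rfl⟩
  refine ⟨T.image star, le_antisymm ?_ ?_, fun e => ?_⟩
  · rw [Submodule.span_le]
    intro D hD
    obtain ⟨q, -, rfl⟩ := Finset.mem_image.1 (Finset.mem_coe.1 hD)
    exact hstar q
  · rintro D ⟨⟨x, rfl⟩, hx⟩
    have hconst : ∀ u v, r u v → x u = x v := by
      intro u v huv
      induction huv with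
      | rel u v h =>
        obtain ⟨e, he, rfl, rfl⟩ := h
        exact (ZMod.two_add_eq_zero_iff _ _).1 (hx e he)
      | refl => rfl
      | symm _ _ _ ih => exact ih.symm
      | trans _ _ _ _ _ ih1 ih2 => exact ih1.trans ih2
    let y : Quotient r → ZMod 2 := Quotient.lift x hconst
    have hy : ∀ v, y (p v) = x v := fun v => rfl
    have hsum : coboundary a b x = ∑ q ∈ T, y q • star q := by
      funext e
      have ha : p (a e) ∈ T := by simp [T]
      have hb : p (b e) ∈ T := by simp [T]
      simp only [Finset.sum_apply, Pi.smul_apply, smul_eq_mul, star, coboundary_apply, mul_add,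
        Finset.sum_add_distrib, mul_ite, mul_one, mul_zero, Finset.sum_ite_eq, ha, hb, if_true, hy]
    rw [hsum]
    exact Submodule.sum_mem _ fun q hq => Submodule.smul_mem _ _
      (Submodule.subset_span (Finset.mem_coe.2 (Finset.mem_image_of_mem _ hq)))
  · have hsub : {B ∈ T.image star | B e ≠ 0} ⊆ ({p (a e), p (b e)} : Finset _).image star := by
      intro B hB
      obtain ⟨hB, hBe⟩ := Finset.mem_filter.1 hB
      obtain ⟨q, -, rfl⟩ := Finset.mem_image.1 hB
      refine Finset.mem_image_of_mem _ ?_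
      by_contra hq
      simp only [Finset.mem_insert, Finset.mem_singleton, not_or] at hq
      exact hBe (by simp [star, coboundary_apply, Ne.symm hq.1, Ne.symm hq.2])
    exact (Finset.card_le_card hsub).trans (Finset.card_image_le.trans Finset.card_le_two)

end CutSpace

/-! ### Spanning forests and independence in terms of cuts -/

namespace Graph

variable {V α : Type*} {G : Graph V α}

theorem IsCycleEdgeSet.exists_reachableIn_diff {C : Set α} (hC : G.IsCycleEdgeSet C) :
    ∃ e ∈ C, ∃ u v, G.IsLink e u v ∧ G.ReachableIn (C \ {e}) u v := by
  obtain ⟨n, v, e, -, he, hl, rfl⟩ := hC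
  refine ⟨e (Fin.last n), ⟨_, rfl⟩, v 0, v (Fin.last n), ?_, ?_⟩
  · have := hl (Fin.last n)
    rw [Fin.last_add_one] at this
    exact this.symm
  · have key : ∀ i : Fin (n + 1),
        G.ReachableIn (Set.range e \ {e (Fin.last n)}) (v 0) (v i) := by
      intro i
      induction i using Fin.induction with
      | zero => exact Relation.ReflTransGen.refl
      | succ i ih =>
        refine ih.tail ⟨e i.castSucc, ⟨⟨_, rfl⟩, fun h => ?_⟩, ?_⟩
        · exact (Fin.castSucc_lt_last i).ne (he h)
        · have := hl i.castSucc
          rwa [Fin.coeSucc_eq_succ] at this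
    exact key _

theorem IsLink.reachableIn {F : Set α} {e : α} {u v : V} (h : G.IsLink e u v) (he : e ∈ F) :
    G.ReachableIn F u v :=
  Relation.ReflTransGen.single ⟨e, he, h⟩

theorem ReachableIn.symm {F : Set α} {x y : V} (h : G.ReachableIn F x y) :
    G.ReachableIn F y x := by
  induction h with
  | refl => exact Relation.ReflTransGen.refl
  | tail _ hbc ih =>
    obtain ⟨e, he, hl⟩ := hbc
    exact Relation.ReflTransGen.head ⟨e, he, hl.symm⟩ ih

theorem ReachableIn.of_forall_link {F F' : Set α}
    (h : ∀ e ∈ F, ∀ u v, G.IsLink e u v → G.ReachableIn F' u v) {x y : V}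
    (hxy : G.ReachableIn F x y) : G.ReachableIn F' x y := by
  induction hxy with
  | refl => exact Relation.ReflTransGen.refl
  | tail _ hbc ih =>
    obtain ⟨e, he, hl⟩ := hbc
    exact ih.trans (h e he _ _ hl)

/-- A set of edges that preserves connectivity contains a spanning forest. -/
theorem exists_isSpanningForest_subset [Finite α] {F₀ : Set α} (hF₀ : F₀ ⊆ G.edgeSet)
    (h : ∀ x y, G.ReachableIn G.edgeSet x y → G.ReachableIn F₀ x y) :
    ∃ F ⊆ F₀, G.IsSpanningForest F := by
  obtain ⟨F, hF, hmin⟩ := exists_minimal_le_of_wellFoundedLT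
    (fun F : Set α => ∀ x y, G.ReachableIn G.edgeSet x y → G.ReachableIn F x y) F₀ h
  refine ⟨F, hF, hF.trans hF₀, fun C hC hCF => ?_, hmin.1⟩
  obtain ⟨e, heC, u, v, hl, huv⟩ := hC.exists_reachableIn_diff
  have huv' : G.ReachableIn (F \ {e}) u v :=
    huv.of_forall_link (F' := F \ {e}) fun f hf a b hab =>
      hab.reachableIn (Set.mem_sdiff_singleton.2 ⟨hCF hf.1, hf.2⟩)
  have hle : F ⊆ F \ {e} := by
    refine hmin.2 (fun x y hxy => ?_) Set.sdiff_subset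
    refine ReachableIn.of_forall_link (fun f hf a b hab => ?_) (hmin.1 x y hxy)
    by_cases hfe : f = e
    · subst hfe
      obtain ⟨rfl, rfl⟩ | ⟨rfl, rfl⟩ := hl.eq_and_eq_or_eq_and_eq hab
      · exact huv'
      · exact huv'.symm
    · exact hab.reachableIn ⟨hf, hfe⟩
  exact (hle (hCF heC)).2 rfl

-- The complement of `S` contains a spanning forest iff deleting `S` separates no component, that
-- is, iff `S` contains no nonempty cut.
open Classical in
theorem IsCographicMatroid.indep_iff [Finite α] {M : Matroid α} (hM : G.IsCographicMatroid M)
    (hE : M.E = Set.univ) {a b : α → V} (hab : ∀ e, G.IsLink e (a e) (b e)) (S : Set α) :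
    M.Indep S ↔ (cutSpace a b).supportedIn S = ⊥ := by
  have hG : G.edgeSet = Set.univ := hM.1 ▸ hE
  rw [hM.2 S (hG ▸ Set.subset_univ S), Submodule.eq_bot_iff]
  constructor
  · rintro ⟨F, hF, hFS⟩ _ ⟨⟨x, rfl⟩, hx⟩
    funext e
    suffices h : x (a e) = x (b e) from (ZMod.two_add_eq_zero_iff _ _).2 h
    have hreach := hF.reachable (a e) (b e) ((hab e).reachableIn (hG ▸ Set.mem_univ e))
    generalize b e = w at hreach
    induction hreach with
    | refl => rfl
    | tail _ huv ih =>
      obtain ⟨f, hf, hl⟩ := huv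
      have hxf : x (a f) = x (b f) := (ZMod.two_add_eq_zero_iff _ _).1 (hx f (hFS hf).2)
      obtain ⟨h1, h2⟩ | ⟨h1, h2⟩ := (hab f).eq_and_eq_or_eq_and_eq hl
      · rw [ih, ← h1, ← h2, hxf]
      · rw [ih, ← h1, ← h2, hxf]
  · intro h
    obtain ⟨F, hFS, hF⟩ := G.exists_isSpanningForest_subset (F₀ := G.edgeSet \ S)
      Set.sdiff_subset (fun y z hyz => by
        -- The coboundary of the component of `y` after deleting `S` is a cut inside `S`, hence
        -- zero, so no edge leaves this component.
        let U : V → ZMod 2 := fun v => if G.ReachableIn (G.edgeSet \ S) y v then 1 else 0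
        have hstep : ∀ e ∉ S, ∀ u v, G.IsLink e u v → G.ReachableIn (G.edgeSet \ S) y u →
            G.ReachableIn (G.edgeSet \ S) y v := fun e he u v hl hu =>
          hu.tail ⟨e, ⟨hl.edge_mem, he⟩, hl⟩
        have hU := h (coboundary a b U) ⟨⟨U, rfl⟩, fun e he => by
          have : G.ReachableIn (G.edgeSet \ S) y (a e) ↔ G.ReachableIn (G.edgeSet \ S) y (b e) :=
            ⟨hstep e he _ _ (hab e), hstep e he _ _ (hab e).symm⟩
          simp only [coboundary_apply, U, this]
          exact (ZMod.two_add_eq_zero_iff _ _).2 rfl⟩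
        have hcross : ∀ e, G.ReachableIn (G.edgeSet \ S) y (a e) ↔
            G.ReachableIn (G.edgeSet \ S) y (b e) := by
          intro e
          have := (ZMod.two_add_eq_zero_iff _ _).1 (congrFun hU e)
          by_cases h1 : G.ReachableIn (G.edgeSet \ S) y (a e) <;>
            by_cases h2 : G.ReachableIn (G.edgeSet \ S) y (b e) <;> simp_all [U]
        induction hyz with
        | refl => exact Relation.ReflTransGen.refl
        | tail _ huv ih =>
          obtain ⟨f, -, hl⟩ := huv
          obtain ⟨rfl, rfl⟩ | ⟨rfl, rfl⟩ := (hab f).eq_and_eq_or_eq_and_eq hl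
          · exact (hcross f).1 ih
          · exact (hcross f).2 ih)
    exact ⟨F, hF, hFS⟩

end Graph

/-- The independent sets of a cographic matroid are the sets containing no nonempty cut of a
multigraph. -/
theorem Matroid.IsCographic.exists_indep_iff {α : Type*} [Finite α] {M : Matroid α}
    (hM : M.IsCographic) (hE : M.E = Set.univ) :
    ∃ X : Submodule (ZMod 2) (α → ZMod 2), X.HereditarilyTwoCovered ∧
      ∀ S, M.Indep S ↔ X.supportedIn S = ⊥ := by
  obtain ⟨V, G, -, hG⟩ := hM
  have hlink : ∀ e, ∃ a b, G.IsLink e a b := fun e =>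
    Graph.exists_isLink_of_mem_edgeSet (hG.1 ▸ hE ▸ Set.mem_univ e : e ∈ G.edgeSet)
  choose a b hab using hlink
  exact ⟨cutSpace a b, hereditarilyTwoCovered_cutSpace a b, hG.indep_iff hE hab⟩

/-! ### Cut counting -/

section CutCounting

variable {α : Type*} [Fintype α]

open Classical in
/-- The set of nonzero coordinates of a vector. -/
noncomputable def coordSupport (D : α → ZMod 2) : Finset α := {e | D e ≠ 0}

theorem mem_coordSupport {D : α → ZMod 2} {e : α} : e ∈ coordSupport D ↔ D e ≠ 0 := by
  simp [coordSupport]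

/-- Every nonzero vector of `X` has at least `γ` nonzero coordinates. -/
def HasGirthAtLeast (X : Submodule (ZMod 2) (α → ZMod 2)) (γ : ℝ) : Prop :=
  ∀ D ∈ X, D ≠ 0 → γ ≤ (coordSupport D).card

theorem HasGirthAtLeast.mono {X Y : Submodule (ZMod 2) (α → ZMod 2)} {γ : ℝ}
    (hX : HasGirthAtLeast X γ) (h : Y ≤ X) : HasGirthAtLeast Y γ :=
  fun D hD => hX D (h hD)

open Classical in
/-- The vectors of `X` with at most `s` nonzero coordinates. -/
noncomputable def lightVectors (X : Submodule (ZMod 2) (α → ZMod 2)) (s : ℕ) :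
    Finset (α → ZMod 2) := {D | D ∈ X ∧ (coordSupport D).card ≤ s}

open Classical in
/-- The coordinates at which some vector of `X` is nonzero. -/
noncomputable def jointSupport (X : Submodule (ZMod 2) (α → ZMod 2)) : Finset α :=
  {e | ∃ D ∈ X, D e ≠ 0}

open Classical in
/-- In a two-covered space of dimension `d` in which all nonzero vectors have size at least `γ`,
at least `d * γ / 2` coordinates are used. -/
theorem Submodule.TwoCovered.finrank_mul_le {X : Submodule (ZMod 2) (α → ZMod 2)} {γ : ℝ}
    (hX : X.TwoCovered) (hγ : 0 ≤ γ) (hg : HasGirthAtLeast X γ) :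
    Module.finrank (ZMod 2) X * γ ≤ 2 * (jointSupport X).card := by
  obtain ⟨𝓑, hspan, hcov⟩ := hX
  have hmem : ∀ B ∈ 𝓑, B ∈ X := fun B hB => hspan ▸ Submodule.subset_span hB
  have hdim : Module.finrank (ZMod 2) X ≤ (𝓑.erase 0).card := by
    have h0 : span (ZMod 2) ((𝓑.erase 0 : Finset _) : Set (α → ZMod 2)) = X := by
      rw [Finset.coe_erase, Submodule.span_sdiff_singleton_zero, hspan]
    rw [← h0]
    exact finrank_span_finset_le_card _
  -- Double counting of incidences between generators and coordinates.
  have hsum : ∑ B ∈ 𝓑.erase 0, (coordSupport B).card ≤ 2 * (jointSupport X).card := by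
    have h1 : ∀ B ∈ 𝓑.erase 0, (coordSupport B).card =
        ∑ e ∈ jointSupport X, if B e ≠ 0 then 1 else 0 := by
      intro B hB
      rw [← Finset.card_filter]
      congr 1
      ext e
      simp only [mem_coordSupport, jointSupport, Finset.mem_filter, Finset.mem_univ, true_and]
      exact ⟨fun h => ⟨⟨B, hmem B (Finset.mem_of_mem_erase hB), h⟩, h⟩, fun h => h.2⟩
    rw [Finset.sum_congr rfl h1, Finset.sum_comm, mul_comm, ← smul_eq_mul]
    refine Finset.sum_le_card_nsmul _ _ _ fun e _ => ?_
    rw [← Finset.card_filter]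
    exact (Finset.card_le_card (Finset.filter_subset_filter _ (Finset.erase_subset _ _))).trans
      (hcov e)
  have h2 : ((𝓑.erase 0).card : ℝ) * γ ≤ ∑ B ∈ 𝓑.erase 0, ((coordSupport B).card : ℝ) := by
    rw [← nsmul_eq_mul]
    exact Finset.card_nsmul_le_sum _ _ _ fun B hB =>
      hg B (hmem B (Finset.mem_of_mem_erase hB)) (Finset.ne_of_mem_erase hB)
  calc Module.finrank (ZMod 2) X * γ ≤ ((𝓑.erase 0).card : ℝ) * γ := by gcongr
    _ ≤ _ := h2
    _ ≤ _ := by exact_mod_cast hsum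

theorem card_lightVectors_le_two_pow (X : Submodule (ZMod 2) (α → ZMod 2)) (s : ℕ) :
    (lightVectors X s).card ≤ 2 ^ Module.finrank (ZMod 2) X := by
  classical
  have h : Fintype.card X = 2 ^ Module.finrank (ZMod 2) X := by
    rw [Module.card_eq_pow_finrank (K := ZMod 2), ZMod.card]
  rw [← h, ← Fintype.card_coe]
  exact Fintype.card_le_of_injective
    (fun D : lightVectors X s => (⟨D.1, by have := D.2; simp [lightVectors] at this; exact this.1⟩ : X))
    fun D D' h => Subtype.ext (congrArg (fun x : X => x.1) h)

-- One averaged contraction step: a light vector vanishes on all but `s` of the used coordinates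
-- `e`, and then survives in the subspace where coordinate `e` is zero.
open Classical in
theorem card_lightVectors_mul_le (X : Submodule (ZMod 2) (α → ZMod 2)) (s Z : ℕ)
    (hZ : ∀ e ∈ jointSupport X, (lightVectors (X.supportedIn {e}ᶜ) s).card ≤ Z) :
    (lightVectors X s).card * (jointSupport X).card ≤
      (jointSupport X).card * Z + (lightVectors X s).card * s := by
  have h1 : ∀ D ∈ lightVectors X s, (jointSupport X).card ≤
      (∑ e ∈ jointSupport X, if D e = 0 then 1 else 0) + s := by
    intro D hD
    simp only [lightVectors, Finset.mem_filter, Finset.mem_univ, true_and] at hD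
    rw [← Finset.card_filter, ← Finset.card_filter_add_card_filter_not (fun e => D e = 0)]
    gcongr
    refine le_trans (Finset.card_le_card fun e he => ?_) hD.2
    exact mem_coordSupport.2 (Finset.mem_filter.1 he).2
  calc (lightVectors X s).card * (jointSupport X).card
      = ∑ D ∈ lightVectors X s, (jointSupport X).card := by simp
    _ ≤ ∑ D ∈ lightVectors X s, ((∑ e ∈ jointSupport X, if D e = 0 then 1 else 0) + s) :=
        Finset.sum_le_sum h1
    _ = (∑ e ∈ jointSupport X, ∑ D ∈ lightVectors X s, if D e = 0 then 1 else 0) +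
          (lightVectors X s).card * s := by
        rw [Finset.sum_add_distrib, Finset.sum_comm]; simp
    _ ≤ (jointSupport X).card * Z + (lightVectors X s).card * s := by
        gcongr
        rw [← smul_eq_mul]
        refine Finset.sum_le_card_nsmul _ _ _ fun e he => le_trans (le_of_eq ?_) (hZ e he)
        rw [← Finset.card_filter]
        congr 1
        ext D
        simp only [lightVectors, Finset.mem_filter, Finset.mem_univ, true_and,
          Submodule.mem_supportedIn, Set.mem_compl_iff, Set.mem_singleton_iff, not_not, forall_eq]
        tauto

theorem finrank_supportedIn_compl_lt {X : Submodule (ZMod 2) (α → ZMod 2)} {e : α}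
    (he : e ∈ jointSupport X) :
    Module.finrank (ZMod 2) (X.supportedIn {e}ᶜ) < Module.finrank (ZMod 2) X := by
  refine Submodule.finrank_lt_finrank_of_lt (lt_of_le_of_ne (fun D hD => hD.1) fun h => ?_)
  simp only [jointSupport, Finset.mem_filter, Finset.mem_univ, true_and] at he
  obtain ⟨D, hD, hDe⟩ := he
  rw [← h] at hD
  exact hDe (hD.2 e (by simp))

/-- Cut counting: if all nonempty cuts have size at least `γ`, then the number of cuts of size at
most `s ≤ a * γ / 2` is polynomial of degree `a`. -/
theorem card_lightVectors_le_choose {γ : ℝ} (hγ : 0 < γ) {a s : ℕ} (has : 2 * s ≤ a * γ) (d : ℕ) :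
    ∀ X : Submodule (ZMod 2) (α → ZMod 2), X.HereditarilyTwoCovered → HasGirthAtLeast X γ →
      Module.finrank (ZMod 2) X = d → (lightVectors X s).card ≤ 2 ^ a * (max d a).choose a := by
  induction d using Nat.strong_induction_on with
  | _ d ih =>
  intro X hX hg hd
  rcases le_or_gt d a with hda | hda
  · rw [max_eq_right hda, Nat.choose_self, mul_one]
    exact (card_lightVectors_le_two_pow X s).trans (Nat.pow_le_pow_right two_pos (hd ▸ hda))
  · obtain ⟨d, rfl⟩ : ∃ d', d = d' + 1 := ⟨d - 1, by omega⟩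
    have hXX : X.supportedIn Set.univ = X := by
      ext D; simp [Submodule.mem_supportedIn]
    have hfin := (hXX ▸ hX Set.univ).finrank_mul_le hγ.le hg
    rw [hd] at hfin
    have hmul := card_lightVectors_mul_le X s (2 ^ a * d.choose a) fun e he => by
      have hlt := finrank_supportedIn_compl_lt he
      rw [hd] at hlt
      refine (ih _ hlt _ (hX.supportedIn _) (hg.mono fun D hD => hD.1) rfl).trans ?_
      gcongr
      omega
    rw [max_eq_left hda.le]
    set A : ℕ := (jointSupport X).card
    set L : ℕ := (lightVectors X s).card
    have hA : 0 < A := by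
      by_contra h0
      have : (A : ℝ) = 0 := by exact_mod_cast Nat.eq_zero_of_not_pos h0
      rw [this] at hfin
      have : (0 : ℝ) < (d + 1 : ℕ) * γ := by positivity
      linarith
    -- A random used coordinate meets a light vector with probability at most s/A ≤ a/(d+1), by the
    -- lower bound on `A` from the dimension.
    have hsd : s * (d + 1) ≤ a * A := by
      have : (s : ℝ) * (d + 1 : ℕ) ≤ a * A := by
        have h1 : (2 * s : ℝ) * (d + 1 : ℕ) ≤ a * γ * (d + 1 : ℕ) := by gcongr
        have h2 : (a : ℝ) * ((d + 1 : ℕ) * γ) ≤ a * (2 * A) := by gcongr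
        nlinarith
      exact_mod_cast this
    -- The survival probability is at least (t+1)/(d+1), which is exactly the ratio of consecutive
    -- binomial coefficients.
    obtain ⟨t, ht⟩ : ∃ t, d + 1 = a + (t + 1) := ⟨d - a, by omega⟩
    have hch : (d + 1) * d.choose a = (d + 1).choose a * (t + 1) := by
      have := Nat.add_one_mul_choose_eq d a
      have h3 := Nat.choose_succ_right_eq (d + 1) a
      rw [show d + 1 - a = t + 1 by omega] at h3
      rw [← h3, ← this]
    have hfinal : A * (t + 1) * L ≤ A * (t + 1) * (2 ^ a * (d + 1).choose a) := by
      have h4 : L * A * (d + 1) ≤ (A * (2 ^ a * d.choose a) + L * s) * (d + 1) := by gcongr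
      have h5 : L * (s * (d + 1)) ≤ L * (a * A) := by gcongr
      have h6 : A * (2 ^ a * d.choose a) * (d + 1) =
          A * (t + 1) * (2 ^ a * (d + 1).choose a) := by
        calc _ = A * 2 ^ a * ((d + 1) * d.choose a) := by ring
          _ = _ := by rw [hch]; ring
      have h7 : L * A * (d + 1) = L * (a * A) + A * (t + 1) * L := by rw [ht]; ring
      nlinarith
    exact Nat.le_of_mul_le_mul_left hfinal (by positivity)

theorem card_lightVectors_le {γ : ℝ} (hγ : 0 < γ) {a s : ℕ} (has : 2 * s ≤ a * γ)
    {X : Submodule (ZMod 2) (α → ZMod 2)} (hX : X.HereditarilyTwoCovered)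
    (hg : HasGirthAtLeast X γ) (hα : 0 < Fintype.card α) :
    (lightVectors X s).card ≤ (2 * Fintype.card α) ^ a := by
  refine (card_lightVectors_le_choose hγ has _ X hX hg rfl).trans ?_
  rw [mul_pow]
  gcongr
  rcases le_total (Module.finrank (ZMod 2) X) a with h | h
  · rw [max_eq_right h, Nat.choose_self]
    exact Nat.one_le_pow _ _ hα
  · rw [max_eq_left h]
    refine (Nat.choose_le_pow _ _).trans (Nat.pow_le_pow_left ?_ _)
    exact (Submodule.finrank_le X).trans (by simp)

end CutCounting

/-! ### Hitting many likely events -/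

section Hitting

open Classical in
/-- Events of probability at least `δ` are all hit by `N` well-chosen points, as soon as
`(1 - δ) ^ N` is less than the reciprocal of the number of events. -/
theorem exists_hitting_family {Ω J : Type*} [Fintype Ω] [Fintype J] {w : Ω → ℝ}
    (hw : ∀ ω, 0 ≤ w ω) (hsum : ∑ ω, w ω = 1) (E : J → Finset Ω) {δ : ℝ} (hδ : δ ≤ 1)
    (hE : ∀ j, δ ≤ ∑ ω ∈ E j, w ω) {N : ℕ} (hN : (1 - δ) ^ N * Fintype.card J < 1) :
    ∃ T : Fin N → Ω, ∀ j, ∃ i, T i ∈ E j := by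
  have key : ∀ n : ℕ, ∃ T : Fin n → Ω,
      (({j | ∀ i, T i ∉ E j} : Finset J).card : ℝ) ≤ (1 - δ) ^ n * Fintype.card J := by
    intro n
    induction n with
    | zero => exact ⟨Fin.elim0, by simp⟩
    | succ n ih =>
      obtain ⟨T, hT⟩ := ih
      set U : Finset J := {j | ∀ i, T i ∉ E j}
      -- A random point misses on average at most a fraction 1 - δ of the events still unhit, so
      -- some point does at least as well.
      have havg : ∑ ω, w ω * (({j ∈ U | ω ∉ E j} : Finset J).card : ℝ) ≤ (1 - δ) * U.card := by
        calc ∑ ω, w ω * (({j ∈ U | ω ∉ E j} : Finset J).card : ℝ)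
            = ∑ ω, ∑ j ∈ U, if ω ∉ E j then w ω else 0 := by
              refine Finset.sum_congr rfl fun ω _ => ?_
              rw [← Finset.sum_filter, Finset.sum_const, nsmul_eq_mul, mul_comm]
          _ = ∑ j ∈ U, ∑ ω, if ω ∉ E j then w ω else 0 := Finset.sum_comm
          _ ≤ ∑ j ∈ U, (1 - δ) := by
              refine Finset.sum_le_sum fun j _ => ?_
              have h1 : ∑ ω, (if ω ∉ E j then w ω else 0) + ∑ ω ∈ E j, w ω = 1 := by
                rw [← hsum, ← Finset.sum_filter, add_comm,
                  ← Finset.sum_filter_add_sum_filter_not Finset.univ (fun ω => ω ∈ E j)]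
                simp
              linarith [hE j]
          _ = (1 - δ) * U.card := by rw [Finset.sum_const, nsmul_eq_mul, mul_comm]
      obtain ⟨ω, hω⟩ : ∃ ω, (({j ∈ U | ω ∉ E j} : Finset J).card : ℝ) ≤ (1 - δ) * U.card := by
        by_contra! hcon
        obtain ⟨ω₀, -, hω₀⟩ : ∃ ω ∈ Finset.univ, (0 : ℝ) < w ω :=
          Finset.exists_lt_of_sum_lt (by simp [hsum])
        have : ∑ ω, w ω * ((1 - δ) * U.card) <
            ∑ ω, w ω * (({j ∈ U | ω ∉ E j} : Finset J).card : ℝ) :=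
          Finset.sum_lt_sum (fun ω _ => mul_le_mul_of_nonneg_left (hcon ω).le (hw ω))
            ⟨ω₀, Finset.mem_univ _, mul_lt_mul_of_pos_left (hcon ω₀) hω₀⟩
        rw [← Finset.sum_mul, hsum, one_mul] at this
        linarith
      refine ⟨Fin.cons ω T, ?_⟩
      have hU : ({j | ∀ i, (Fin.cons ω T : Fin (n + 1) → Ω) i ∉ E j} : Finset J) =
          ({j ∈ U | ω ∉ E j} : Finset J) := by
        ext j
        simp [U, Fin.forall_fin_succ, and_comm]
      rw [hU, pow_succ', mul_assoc]
      exact hω.trans (mul_le_mul_of_nonneg_left hT (by linarith))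
  obtain ⟨T, hT⟩ := key N
  refine ⟨T, fun j => ?_⟩
  by_contra! hj
  have h0 : (1 : ℝ) ≤ (({j | ∀ i, T i ∉ E j} : Finset J).card : ℝ) := by
    exact_mod_cast Finset.card_pos.2 ⟨j, by simpa using hj⟩
  linarith

end Hitting

/-! ### Isolating short cuts by random sampling -/

section Sampling

variable {α : Type*} [Fintype α] [DecidableEq α]

/-- The probability of `S` when every element is chosen independently with probability `p`. -/
def bernoulliWeight (p : ℝ) (S : Finset α) : ℝ := p ^ S.card * (1 - p) ^ (Sᶜ).card

theorem bernoulliWeight_nonneg {p : ℝ} (h0 : 0 ≤ p) (h1 : p ≤ 1) (S : Finset α) :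
    0 ≤ bernoulliWeight p S :=
  mul_nonneg (pow_nonneg h0 _) (pow_nonneg (by linarith) _)

theorem sum_bernoulliWeight_superset (p : ℝ) (C : Finset α) :
    ∑ S : Finset α, (if C ⊆ S then bernoulliWeight p S else 0) = p ^ C.card := by
  have h := Finset.prod_add (fun _ : α => p) (fun i => if i ∈ C then 0 else 1 - p) Finset.univ
  have hleft : ∏ i : α, (p + if i ∈ C then 0 else 1 - p) = p ^ C.card := by
    rw [Finset.prod_congr rfl (g := fun i => if i ∈ C then p else 1)
      fun i _ => by split_ifs <;> ring, Finset.prod_ite_mem, Finset.univ_inter, Finset.prod_const]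
  rw [← hleft, h, Finset.powerset_univ]
  refine Finset.sum_congr rfl fun S _ => ?_
  rw [Finset.prod_const, ← Finset.compl_eq_univ_sdiff]
  split_ifs with hCS
  · have hcompl : ∀ i ∈ Sᶜ, (if i ∈ C then 0 else 1 - p) = 1 - p := fun i hi =>
      if_neg fun hiC => Finset.mem_compl.1 hi (hCS hiC)
    rw [Finset.prod_congr rfl hcompl, Finset.prod_const, bernoulliWeight]
  · obtain ⟨i, hiC, hiS⟩ := Finset.not_subset.1 hCS
    rw [Finset.prod_eq_zero (Finset.mem_compl.2 hiS) (by simp [hiC]), mul_zero]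

theorem sum_bernoulliWeight (p : ℝ) : ∑ S : Finset α, bernoulliWeight p S = 1 := by
  simpa using sum_bernoulliWeight_superset p (∅ : Finset α)

open Classical in
/-- The sets that contain the support of `C` but of no other nonzero vector of `X`. -/
noncomputable def isolatingSets (X : Submodule (ZMod 2) (α → ZMod 2)) (C : α → ZMod 2) :
    Finset (Finset α) :=
  {S | coordSupport C ⊆ S ∧ ∀ D ∈ X, D ≠ 0 → coordSupport D ⊆ S → D = C}

theorem mem_isolatingSets {X : Submodule (ZMod 2) (α → ZMod 2)} {C : α → ZMod 2} {S : Finset α} :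
    S ∈ isolatingSets X C ↔
      coordSupport C ⊆ S ∧ ∀ D ∈ X, D ≠ 0 → coordSupport D ⊆ S → D = C := by
  simp [isolatingSets]

open Classical in
/-- The nonzero vectors of `X` other than `C`. -/
noncomputable def competitors (X : Submodule (ZMod 2) (α → ZMod 2)) (C : α → ZMod 2) :
    Finset (α → ZMod 2) := {D | D ∈ X ∧ D ≠ 0 ∧ D ≠ C}

theorem mem_competitors {X : Submodule (ZMod 2) (α → ZMod 2)} {C D : α → ZMod 2} :
    D ∈ competitors X C ↔ D ∈ X ∧ D ≠ 0 ∧ D ≠ C := by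
  simp [competitors]

/-- Union bound: once `C` is inside the sample, a competitor `D` is inside with conditional
probability `p` to the size of `D \ C`. -/
theorem le_sum_isolatingSets {p : ℝ} (h0 : 0 ≤ p) (h1 : p ≤ 1)
    (X : Submodule (ZMod 2) (α → ZMod 2)) (C : α → ZMod 2) :
    p ^ (coordSupport C).card *
        (1 - ∑ D ∈ competitors X C, p ^ (coordSupport D \ coordSupport C).card) ≤
      ∑ S ∈ isolatingSets X C, bernoulliWeight p S := by
  have hunion : ∀ D : α → ZMod 2,
      p ^ (coordSupport C).card * p ^ (coordSupport D \ coordSupport C).card =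
        ∑ S : Finset α, if coordSupport C ∪ coordSupport D ⊆ S then bernoulliWeight p S else 0 := by
    intro D
    rw [sum_bernoulliWeight_superset, ← pow_add, ← Finset.card_union_of_disjoint
      Finset.disjoint_sdiff, Finset.union_sdiff_self_eq_union]
  rw [mul_sub, mul_one, Finset.mul_sum, Finset.sum_congr rfl fun D _ => hunion D,
    Finset.sum_comm, ← sum_bernoulliWeight_superset p (coordSupport C), ← Finset.sum_sub_distrib,
    ← Finset.sum_filter_add_sum_filter_not Finset.univ (· ∈ isolatingSets X C)]
  have hpos : ∀ S : Finset α, ∀ D ∈ competitors X C,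
      0 ≤ if coordSupport C ∪ coordSupport D ⊆ S then bernoulliWeight p S else 0 := by
    intro S D _
    split_ifs
    exacts [bernoulliWeight_nonneg h0 h1 S, le_rfl]
  have hin : ∑ S ∈ Finset.univ.filter (· ∈ isolatingSets X C),
      ((if coordSupport C ⊆ S then bernoulliWeight p S else 0) - ∑ D ∈ competitors X C,
        if coordSupport C ∪ coordSupport D ⊆ S then bernoulliWeight p S else 0) ≤
      ∑ S ∈ isolatingSets X C, bernoulliWeight p S := by
    rw [Finset.filter_mem_eq_inter, Finset.univ_inter]
    refine Finset.sum_le_sum fun S hS => ?_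
    rw [if_pos (mem_isolatingSets.1 hS).1]
    linarith [Finset.sum_nonneg (hpos S)]
  have hout : ∑ S ∈ Finset.univ.filter (· ∉ isolatingSets X C),
      ((if coordSupport C ⊆ S then bernoulliWeight p S else 0) - ∑ D ∈ competitors X C,
        if coordSupport C ∪ coordSupport D ⊆ S then bernoulliWeight p S else 0) ≤ 0 := by
    refine Finset.sum_nonpos fun S hS => ?_
    have hS' := (Finset.mem_filter.1 hS).2
    by_cases hCS : coordSupport C ⊆ S
    · rw [mem_isolatingSets] at hS'
      push Not at hS'
      obtain ⟨D, hDX, hD0, hDS, hDC⟩ := hS' hCS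
      have := Finset.single_le_sum (hpos S) (mem_competitors.2 ⟨hDX, hD0, hDC⟩)
      rw [if_pos (Finset.union_subset hCS hDS)] at this
      rw [if_pos hCS]
      linarith
    · rw [if_neg hCS]
      linarith [Finset.sum_nonneg (hpos S)]
  linarith

/-- If `C` has at most `3γ/2` nonzero coordinates, then a fixed fraction of every other vector
lies outside `C`. -/
theorem card_le_seven_mul_card_sdiff {X : Submodule (ZMod 2) (α → ZMod 2)} {γ : ℝ}
    (hg : HasGirthAtLeast X γ) {C D : α → ZMod 2} (hC : C ∈ X)
    (hCγ : ((coordSupport C).card : ℝ) ≤ 3 / 2 * γ) (hD : D ∈ competitors X C) :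
    ((coordSupport D).card : ℝ) ≤ 7 * (coordSupport D \ coordSupport C).card := by
  obtain ⟨hDX, hD0, hDC⟩ := mem_competitors.1 hD
  have hsub : coordSupport (D + C) ⊆
      (coordSupport D \ coordSupport C) ∪ (coordSupport C \ coordSupport D) := by
    intro e
    simp only [Finset.mem_union, Finset.mem_sdiff, mem_coordSupport, Pi.add_apply]
    generalize D e = x
    generalize C e = y
    revert x y
    decide
  have h1 := hg (D + C) (X.add_mem hDX hC) fun h =>
    hDC (funext fun e => (ZMod.two_add_eq_zero_iff _ _).1 (congrFun h e))
  have h2 : ((coordSupport (D + C)).card : ℝ) ≤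
      (coordSupport D \ coordSupport C).card + (coordSupport C \ coordSupport D).card := by
    exact_mod_cast (Finset.card_le_card hsub).trans (Finset.card_union_le _ _)
  have h3 := hg D hDX hD0
  have h4 : ((coordSupport D \ coordSupport C).card : ℝ) + (coordSupport D ∩ coordSupport C).card =
      (coordSupport D).card := by exact_mod_cast Finset.card_sdiff_add_card_inter _ _
  have h5 : ((coordSupport C \ coordSupport D).card : ℝ) + (coordSupport C ∩ coordSupport D).card =
      (coordSupport C).card := by exact_mod_cast Finset.card_sdiff_add_card_inter _ _
  rw [Finset.inter_comm] at h5
  linarith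

/-- The sampling probability `m ^ (-56 / γ)`. -/
noncomputable def samplingProb (m : ℕ) (γ : ℝ) : ℝ := (m : ℝ) ^ (-(56 / γ))

theorem samplingProb_pow (m : ℕ) (γ : ℝ) (n : ℕ) :
    samplingProb m γ ^ n = (m : ℝ) ^ (-(56 / γ * n)) := by
  rw [samplingProb, ← Real.rpow_mul_natCast (Nat.cast_nonneg m), neg_mul]

/-- As 56 = 7 · 8, a competitor of size s costs at most m^(-8s/γ), while cut counting allows at most
m^(6s/γ) of them. Since s ≥ γ, each size contributes at most m^(-2). -/
theorem sum_competitors_le {X : Submodule (ZMod 2) (α → ZMod 2)} {γ : ℝ} (hγ : 0 < γ)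
    (hX : X.HereditarilyTwoCovered) (hg : HasGirthAtLeast X γ) (hm : 2 ≤ Fintype.card α)
    {C : α → ZMod 2} (hC : C ∈ X) (hCγ : ((coordSupport C).card : ℝ) ≤ 3 / 2 * γ) :
    ∑ D ∈ competitors X C,
      samplingProb (Fintype.card α) γ ^ (coordSupport D \ coordSupport C).card ≤ 1 / 2 := by
  set m := Fintype.card α
  have hm1 : (1 : ℝ) ≤ m := by exact_mod_cast (by omega : 1 ≤ m)
  have hm2 : (2 : ℝ) ≤ m := by exact_mod_cast hm
  have hterm : ∀ D ∈ competitors X C,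
      samplingProb m γ ^ (coordSupport D \ coordSupport C).card ≤
        (m : ℝ) ^ (-(8 * (coordSupport D).card / γ)) := by
    intro D hD
    rw [samplingProb_pow]
    refine Real.rpow_le_rpow_of_exponent_le hm1 (neg_le_neg ?_)
    rw [div_mul_eq_mul_div]
    gcongr ?_ / _
    linarith [card_le_seven_mul_card_sdiff hg hC hCγ hD]
  have hmaps : ∀ D ∈ competitors X C, (coordSupport D).card ∈ Finset.Icc 1 m := by
    intro D hD
    have h := hg D (mem_competitors.1 hD).1 (mem_competitors.1 hD).2.1
    refine Finset.mem_Icc.2 ⟨?_, Finset.card_le_univ _⟩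
    by_contra hlt
    have : ((coordSupport D).card : ℝ) = 0 := by exact_mod_cast (by omega)
    linarith
  have hfiber : ∀ s ∈ Finset.Icc 1 m,
      ∑ D ∈ competitors X C with (coordSupport D).card = s,
        (m : ℝ) ^ (-(8 * (coordSupport D).card / γ)) ≤ (m : ℝ) ^ (-2 : ℝ) := by
    intro s _
    rcases Finset.eq_empty_or_nonempty ({D ∈ competitors X C | (coordSupport D).card = s})
      with hemp | ⟨D₀, hD₀⟩
    · rw [hemp, Finset.sum_empty]
      positivity
    have hγs : γ ≤ s := by
      obtain ⟨h1, h2⟩ := Finset.mem_filter.1 hD₀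
      exact h2 ▸ hg D₀ (mem_competitors.1 h1).1 (mem_competitors.1 h1).2.1
    have hs1 : 1 ≤ s / γ := (one_le_div hγ).2 hγs
    -- The least degree for which cut counting covers size `s`; rounding up costs at most s/γ
    -- because s ≥ γ.
    set a : ℕ := ⌈2 * s / γ⌉₊
    have ha1 : 2 * (s : ℝ) ≤ a * γ := (div_le_iff₀ hγ).1 (Nat.le_ceil _)
    have ha2 : (a : ℝ) ≤ 3 * (s / γ) := by
      have : (a : ℝ) < 2 * s / γ + 1 := Nat.ceil_lt_add_one (by positivity)
      rw [mul_div_assoc] at this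
      linarith
    have hcard : (({D ∈ competitors X C | (coordSupport D).card = s} : Finset _).card : ℝ) ≤
        (m : ℝ) ^ (6 * (s / γ)) := by
      have h1 : ({D ∈ competitors X C | (coordSupport D).card = s} : Finset _) ⊆
          lightVectors X s := by
        intro D hD
        obtain ⟨h1, h2⟩ := Finset.mem_filter.1 hD
        simp [lightVectors, (mem_competitors.1 h1).1, h2]
      have h2 := (Finset.card_le_card h1).trans
        (card_lightVectors_le hγ ha1 hX hg (by omega))
      calc _ ≤ ((2 * m : ℝ)) ^ a := by exact_mod_cast h2
        _ ≤ ((m : ℝ) ^ 2) ^ a := by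
          gcongr
          nlinarith
        _ = (m : ℝ) ^ (2 * a : ℝ) := by
          rw [← pow_mul, ← Real.rpow_natCast]
          push_cast
          rfl
        _ ≤ _ := Real.rpow_le_rpow_of_exponent_le hm1 (by linarith)
    rw [Finset.sum_congr rfl (g := fun _ => (m : ℝ) ^ (-(8 * (s / γ)))) fun D hD => by
      rw [(Finset.mem_filter.1 hD).2, mul_div_assoc], Finset.sum_const, nsmul_eq_mul]
    calc _ ≤ (m : ℝ) ^ (6 * (s / γ)) * (m : ℝ) ^ (-(8 * (s / γ))) := by gcongr
      _ = (m : ℝ) ^ (6 * (s / γ) + -(8 * (s / γ))) := (Real.rpow_add (by linarith) _ _).symm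
      _ ≤ _ := Real.rpow_le_rpow_of_exponent_le hm1 (by linarith)
  calc _ ≤ ∑ D ∈ competitors X C, (m : ℝ) ^ (-(8 * (coordSupport D).card / γ)) :=
        Finset.sum_le_sum hterm
    _ = ∑ s ∈ Finset.Icc 1 m, ∑ D ∈ competitors X C with (coordSupport D).card = s,
        (m : ℝ) ^ (-(8 * (coordSupport D).card / γ)) :=
        (Finset.sum_fiberwise_of_maps_to hmaps _).symm
    _ ≤ ∑ s ∈ Finset.Icc 1 m, (m : ℝ) ^ (-2 : ℝ) := Finset.sum_le_sum hfiber
    _ = m * (m : ℝ) ^ (-2 : ℝ) := by simp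
    _ = 1 / m := by
        rw [Real.rpow_neg (by linarith), Real.rpow_two]
        field_simp
    _ ≤ 1 / 2 := by gcongr

theorem le_sum_isolatingSets_samplingProb {X : Submodule (ZMod 2) (α → ZMod 2)} {γ : ℝ}
    (hγ : 0 < γ) (hX : X.HereditarilyTwoCovered) (hg : HasGirthAtLeast X γ)
    (hm : 2 ≤ Fintype.card α) {C : α → ZMod 2} (hC : C ∈ X)
    (hCγ : ((coordSupport C).card : ℝ) ≤ 3 / 2 * γ) :
    ((Fintype.card α : ℝ) ^ 85)⁻¹ ≤
      ∑ S ∈ isolatingSets X C, bernoulliWeight (samplingProb (Fintype.card α) γ) S := by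
  have hsum := sum_competitors_le hγ hX hg hm hC hCγ
  set m := Fintype.card α
  have hm1 : (1 : ℝ) ≤ m := by exact_mod_cast (by omega : 1 ≤ m)
  have hm2 : (2 : ℝ) ≤ m := by exact_mod_cast hm
  have hp0 : 0 ≤ samplingProb m γ := Real.rpow_nonneg (by linarith) _
  have hp1 : samplingProb m γ ≤ 1 :=
    Real.rpow_le_one_of_one_le_of_nonpos hm1 (by simp only [Left.neg_nonpos_iff]; positivity)
  refine le_trans ?_ (le_sum_isolatingSets hp0 hp1 X C)
  -- 84 = 56 · 3/2; the remaining factor 1/2 is absorbed by 1/m.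
  have hpow : ((m : ℝ) ^ 84)⁻¹ ≤ samplingProb m γ ^ (coordSupport C).card := by
    rw [samplingProb_pow, ← Real.rpow_natCast, ← Real.rpow_neg (by linarith)]
    refine Real.rpow_le_rpow_of_exponent_le hm1 (neg_le_neg ?_)
    rw [div_mul_eq_mul_div, div_le_iff₀ hγ]
    push_cast
    linarith
  calc ((m : ℝ) ^ 85)⁻¹ = ((m : ℝ) ^ 84)⁻¹ * (m : ℝ)⁻¹ := by rw [pow_succ, mul_inv]
    _ ≤ ((m : ℝ) ^ 84)⁻¹ * (1 / 2) := by
        rw [one_div]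
        gcongr
    _ ≤ _ := mul_le_mul hpow (by linarith) (by norm_num) (by positivity)

/-- A projection onto `X` maps the unit vectors to generators. Indexing subspaces by such tuples
bounds their number by 2^(m²). -/
theorem Submodule.exists_span_range_eq (X : Submodule (ZMod 2) (α → ZMod 2)) :
    ∃ f : α → α → ZMod 2, span (ZMod 2) (Set.range f) = X := by
  obtain ⟨g, hg⟩ := LinearMap.exists_leftInverse_of_injective X.subtype X.ker_subtype
  refine ⟨fun i => g fun j => if i = j then 1 else 0, le_antisymm ?_ fun D hD => ?_⟩
  · rw [span_le]
    rintro _ ⟨i, rfl⟩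
    exact (g _).2
  · have h1 : (g D : α → ZMod 2) = D := congrArg Subtype.val (LinearMap.congr_fun hg ⟨D, hD⟩)
    rw [← h1, LinearMap.pi_apply_eq_sum_univ g D, AddSubmonoidClass.coe_finsetSum]
    exact Submodule.sum_mem _ fun i _ => smul_mem _ _ (subset_span ⟨i, rfl⟩)

/-- A polynomial number of sets isolates all short vectors of all two-covered spaces. -/
theorem exists_isolating_family (hm : 2 ≤ Fintype.card α) {γ : ℝ} (hγ : 0 < γ) :
    ∃ T : Fin (Fintype.card α ^ 88) → Finset α,
      ∀ X : Submodule (ZMod 2) (α → ZMod 2), X.HereditarilyTwoCovered → HasGirthAtLeast X γ →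
        ∀ C ∈ X, ((coordSupport C).card : ℝ) ≤ 3 / 2 * γ → ∃ i, T i ∈ isolatingSets X C := by
  classical
  have hsmall := @le_sum_isolatingSets_samplingProb α _ _
  set m := Fintype.card α with hmdef
  have hm1 : (1 : ℝ) ≤ m := by exact_mod_cast (by omega : 1 ≤ m)
  have hm2 : (2 : ℝ) ≤ m := by exact_mod_cast hm
  have hp0 : 0 ≤ samplingProb m γ := Real.rpow_nonneg (by linarith) _
  have hp1 : samplingProb m γ ≤ 1 :=
    Real.rpow_le_one_of_one_le_of_nonpos hm1 (by simp only [Left.neg_nonpos_iff]; positivity)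
  set δ : ℝ := ((m : ℝ) ^ 85)⁻¹
  let E : (α → α → ZMod 2) × (α → ZMod 2) → Finset (Finset α) := fun j =>
    isolatingSets (Submodule.span (ZMod 2) (Set.range j.1)) j.2
  let J := {j // δ ≤ ∑ S ∈ E j, bernoulliWeight (samplingProb m γ) S}
  have hcard : Fintype.card J ≤ 2 ^ (m ^ 2 + m) := by
    refine (Fintype.card_subtype_le _).trans (le_of_eq ?_)
    rw [Fintype.card_prod, Fintype.card_fun, Fintype.card_fun, ZMod.card, ← hmdef, ← pow_mul,
      ← pow_add, sq]
  have hδ : δ ≤ 1 := inv_le_one_of_one_le₀ (one_le_pow₀ hm1)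
  -- 88 = 85 + 3: the failure probability is at most exp(-m³), and m³ ≥ m² + m for m ≥ 2.
  have hN : (1 - δ) ^ (m ^ 88) * Fintype.card J < 1 := by
    have h1 : (1 - δ) ^ (m ^ 88) ≤ Real.exp (-(m : ℝ) ^ 3) := by
      calc (1 - δ) ^ (m ^ 88) ≤ Real.exp (-δ) ^ (m ^ 88) :=
            pow_le_pow_left₀ (by linarith) (Real.one_sub_le_exp_neg δ) _
        _ = Real.exp (-(m : ℝ) ^ 3) := by
            rw [← Real.exp_nat_mul]
            congr 1
            simp only [δ]
            push_cast
            field_simp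
    have h2 : (Fintype.card J : ℝ) < Real.exp ((m : ℝ) ^ 3) := by
      calc (Fintype.card J : ℝ) ≤ 2 ^ (m ^ 2 + m) := by exact_mod_cast hcard
        _ < Real.exp 1 ^ (m ^ 2 + m) :=
            pow_lt_pow_left₀ (by linarith [Real.exp_one_gt_d9]) (by norm_num) (by positivity)
        _ = Real.exp (m ^ 2 + m) := by
            rw [← Real.exp_nat_mul]
            push_cast
            rw [mul_one]
        _ ≤ Real.exp ((m : ℝ) ^ 3) := by
            refine Real.exp_le_exp.2 ?_
            nlinarith [mul_le_mul_of_nonneg_left hm2 (sq_nonneg (m : ℝ))]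
    calc (1 - δ) ^ (m ^ 88) * Fintype.card J
        ≤ Real.exp (-(m : ℝ) ^ 3) * Fintype.card J := by gcongr
      _ < Real.exp (-(m : ℝ) ^ 3) * Real.exp ((m : ℝ) ^ 3) := by gcongr
      _ = 1 := by rw [← Real.exp_add]; simp
  obtain ⟨T, hT⟩ := exists_hitting_family (bernoulliWeight_nonneg hp0 hp1)
    (sum_bernoulliWeight _) (fun j : J => E j.1) hδ (fun j => j.2) hN
  refine ⟨T, fun X hX hg C hC hCγ => ?_⟩
  obtain ⟨f, rfl⟩ := X.exists_span_range_eq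
  exact hT ⟨(f, C), hsmall hγ hX hg hm hC hCγ⟩

end Sampling

/-! ### The sieving algorithm -/

namespace ParallelDecisionTree

variable {m N : ℕ}

/-- The elements of `S ∩ R` that are smaller than `x` and, if `b` is true, `x` itself. -/
def initialPart (S R : Finset (Fin m)) (x : Fin m) (b : Bool) : Finset (Fin m) :=
  {y ∈ S ∩ R | y < x ∨ b = true ∧ y = x}

theorem mem_initialPart {S R : Finset (Fin m)} {x y : Fin m} {b : Bool} :
    y ∈ initialPart S R x b ↔ (y ∈ S ∧ y ∈ R) ∧ (y < x ∨ b = true ∧ y = x) := by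
  simp [initialPart]

/-- The elements of `R` that are not seen to depend on smaller ones: `ans i x b` is the answer to
the query `initialPart (T i) R x b`. -/
def survivors (R : Finset (Fin m)) (ans : Fin N → Fin m → Bool → Bool) : Finset (Fin m) :=
  {x ∈ R | ¬ ∃ i, ans i x false = true ∧ ans i x true = false}

theorem mem_survivors {R : Finset (Fin m)} {ans : Fin N → Fin m → Bool → Bool} {x : Fin m} :
    x ∈ survivors R ans ↔ x ∈ R ∧ ¬ ∃ i, ans i x false = true ∧ ans i x true = false := by
  simp [survivors]

/-- The algorithm that, for `n` rounds starting with round `t`, deletes the elements of the current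
set `R` that are seen to depend on smaller ones inside one of the test sets of the round. -/
noncomputable def sieve (T : ℕ → Fin N → Finset (Fin m)) :
    ℕ → ℕ → Finset (Fin m) → ParallelDecisionTree m
  | 0, _, R => leaf R
  | n + 1, t, R =>
    query (Fintype.card (Fin N × Fin m × Bool))
      (fun j => initialPart (T t ((Fintype.equivFin (Fin N × Fin m × Bool)).symm j).1) R
        ((Fintype.equivFin (Fin N × Fin m × Bool)).symm j).2.1
        ((Fintype.equivFin (Fin N × Fin m × Bool)).symm j).2.2)
      (fun ans => sieve T n (t + 1)
        (survivors R fun i x b => ans (Fintype.equivFin (Fin N × Fin m × Bool) (i, x, b))))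

/-- The output of `sieve` when the queries are answered by `O`. -/
def sieveOutput (O : Finset (Fin m) → Bool) (T : ℕ → Fin N → Finset (Fin m)) :
    ℕ → ℕ → Finset (Fin m) → Finset (Fin m)
  | 0, _, R => R
  | n + 1, t, R =>
    sieveOutput O T n (t + 1) (survivors R fun i x b => O (initialPart (T t i) R x b))

theorem outputDist_sieve (O : Finset (Fin m) → Bool) (T : ℕ → Fin N → Finset (Fin m)) (n : ℕ) :
    ∀ t R, (sieve T n t R).outputDist O = PMF.pure (sieveOutput O T n t R) := by
  induction n with
  | zero => intro t R; rfl
  | succ n ih =>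
    intro t R
    rw [sieve, outputDist, ih, sieveOutput]
    simp

theorem rounds_sieve_le (T : ℕ → Fin N → Finset (Fin m)) (n : ℕ) :
    ∀ t R, (sieve T n t R).rounds ≤ n := by
  induction n with
  | zero => intro t R; exact le_rfl
  | succ n ih =>
    intro t R
    rw [sieve, rounds, add_comm]
    exact Nat.succ_le_succ (Finset.sup_le fun ans _ => ih _ _)

theorem queriesPerRound_sieve_le (T : ℕ → Fin N → Finset (Fin m)) (n : ℕ) :
    ∀ t R, (sieve T n t R).queriesPerRound ≤ N * (m * 2) := by
  induction n with
  | zero => intro t R; exact Nat.zero_le _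
  | succ n ih =>
    intro t R
    rw [sieve, queriesPerRound]
    exact max_le (by simp) (Finset.sup_le fun ans _ => ih _ _)

theorem basisProb_eq_one {T : ParallelDecisionTree m} {M : Matroid (Fin m)} {B : Finset (Fin m)}
    (hT : T.outputDist M.indepOracle = PMF.pure B) (hB : M.IsBase (B : Set (Fin m))) :
    T.basisProb M = 1 := by
  rw [basisProb, hT, PMF.toOuterMeasure_pure_apply, if_pos (by exact hB), ENNReal.toReal_one]

theorem _root_.Matroid.indepOracle_eq_true {M : Matroid (Fin m)} {S : Finset (Fin m)} :
    M.indepOracle S = true ↔ M.Indep (S : Set (Fin m)) := by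
  simp [Matroid.indepOracle]

theorem _root_.Matroid.indepOracle_eq_false {M : Matroid (Fin m)} {S : Finset (Fin m)} :
    M.indepOracle S = false ↔ ¬ M.Indep (S : Set (Fin m)) := by
  simp [Matroid.indepOracle]

/-- A deleted `x` lies in the closure of smaller elements of `R`, possibly deleted themselves;
induction on the order puts all of `R` in the closure of the survivors. -/
theorem spanning_survivors {M : Matroid (Fin m)} (hE : M.E = Set.univ)
    (T : Fin N → Finset (Fin m)) {R : Finset (Fin m)} (hR : M.Spanning (R : Set (Fin m))) :
    M.Spanning
      (survivors R fun i x b => M.indepOracle (initialPart (T i) R x b) : Set (Fin m)) := by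
  have hground : ∀ S : Set (Fin m), S ⊆ M.E := fun S => hE ▸ Set.subset_univ S
  set R' := survivors R fun i x b => M.indepOracle (initialPart (T i) R x b) with hR'
  have key : ∀ x : Fin m, x ∈ R → x ∈ M.closure (R' : Set (Fin m)) := by
    intro x
    induction x using WellFoundedLT.induction with
    | _ x ih =>
    intro hx
    by_cases hxR : x ∈ R'
    · exact M.mem_closure_of_mem (Finset.mem_coe.2 hxR) (hground _)
    · have hx' : ∃ i, M.indepOracle (initialPart (T i) R x false) = true ∧
          M.indepOracle (initialPart (T i) R x true) = false := by
        by_contra hcon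
        exact hxR (mem_survivors.2 ⟨hx, hcon⟩)
      obtain ⟨i, hi, hd⟩ := hx'
      rw [Matroid.indepOracle_eq_true] at hi
      rw [Matroid.indepOracle_eq_false] at hd
      have hsub : (initialPart (T i) R x true : Set (Fin m)) ⊆
          insert x (initialPart (T i) R x false : Set (Fin m)) := by
        intro y hy
        simp only [Finset.mem_coe, mem_initialPart, Set.mem_insert_iff] at hy ⊢
        tauto
      have hcl : x ∈ M.closure (initialPart (T i) R x false : Set (Fin m)) := by
        rw [hi.mem_closure_iff]
        by_cases hxI : x ∈ (initialPart (T i) R x false : Set (Fin m))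
        · exact Or.inr hxI
        · exact Or.inl ⟨fun h => hd (h.subset hsub), hground _⟩
      refine M.closure_subset_closure_of_subset_closure (fun y hy => ?_) hcl
      simp only [Finset.mem_coe, mem_initialPart, Bool.false_eq_true, false_and, or_false] at hy
      exact ih y hy.2 hy.1.2
  rw [Matroid.spanning_iff_ground_subset_closure (hground _)]
  rw [Matroid.spanning_iff_ground_subset_closure (hground _)] at hR
  exact hR.trans (M.closure_subset_closure_of_subset_closure key)

/-- If a short cut survived, its isolating test set would have deleted its largest element: the
prefix before that element contains no nonempty cut, and the prefix including it contains `C`. -/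
theorem hasGirthAtLeast_survivors {M : Matroid (Fin m)}
    {X : Submodule (ZMod 2) (Fin m → ZMod 2)} (hMX : ∀ S, M.Indep S ↔ X.supportedIn S = ⊥)
    {T : Fin N → Finset (Fin m)} {R : Finset (Fin m)} {γ : ℝ}
    (hT : ∀ C ∈ X.supportedIn R, ((coordSupport C).card : ℝ) ≤ 3 / 2 * γ →
      ∃ i, T i ∈ isolatingSets (X.supportedIn R) C) :
    HasGirthAtLeast (X.supportedIn
      (survivors R fun i x b => M.indepOracle (initialPart (T i) R x b) : Set (Fin m)))
      (3 / 2 * γ) := by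
  set R' := survivors R fun i x b => M.indepOracle (initialPart (T i) R x b) with hR'
  intro C hC hC0
  by_contra! hlt
  have hR'R : (R' : Set (Fin m)) ⊆ R := fun x hx => (mem_survivors.1 hx).1
  have hCR := Submodule.supportedIn_mono hR'R hC
  obtain ⟨i, hi⟩ := hT C hCR hlt.le
  rw [mem_isolatingSets] at hi
  have hne : (coordSupport C).Nonempty := by
    obtain ⟨e, he⟩ := Function.ne_iff.1 hC0
    exact ⟨e, mem_coordSupport.2 he⟩
  set x := (coordSupport C).max' hne
  have hx : x ∈ coordSupport C := Finset.max'_mem _ _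
  have hxR' : x ∈ R' := by
    by_contra h
    exact mem_coordSupport.1 hx (hC.2 x h)
  refine (mem_survivors.1 hxR').2 ⟨i, ?_, ?_⟩
  · rw [Matroid.indepOracle_eq_true, hMX, Submodule.eq_bot_iff]
    intro D hD
    by_contra hD0
    have hsupp : ∀ e ∈ coordSupport D, e ∈ initialPart (T i) R x false := fun e he => by
      by_contra h
      exact mem_coordSupport.1 he (hD.2 e h)
    have hDC : D = C := hi.2 D
      ⟨hD.1, fun e he => by
        by_contra h
        exact he (mem_initialPart.1 (hsupp e (mem_coordSupport.2 h))).1.2⟩ hD0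
      fun e he => (mem_initialPart.1 (hsupp e he)).1.1
    simpa [mem_initialPart] using hsupp x (hDC ▸ hx)
  · rw [Matroid.indepOracle_eq_false, hMX, Submodule.eq_bot_iff]
    intro h
    refine hC0 (h C ⟨hC.1, fun e he => ?_⟩)
    by_contra hCe
    have hCe' := mem_coordSupport.2 hCe
    refine he (mem_initialPart.2 ⟨⟨hi.1 hCe', ?_⟩, ?_⟩)
    · by_contra h
      exact hCe (hCR.2 e h)
    · rcases ((coordSupport C).le_max' e hCe').lt_or_eq with h | h
      exacts [Or.inl h, Or.inr ⟨rfl, h⟩]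

theorem sieveOutput_spec {M : Matroid (Fin m)} (hE : M.E = Set.univ)
    {X : Submodule (ZMod 2) (Fin m → ZMod 2)} (hX : X.HereditarilyTwoCovered)
    (hMX : ∀ S, M.Indep S ↔ X.supportedIn S = ⊥) {T : ℕ → Fin N → Finset (Fin m)}
    (hT : ∀ t, ∀ Y : Submodule (ZMod 2) (Fin m → ZMod 2), Y.HereditarilyTwoCovered →
      HasGirthAtLeast Y ((3 / 2) ^ t) → ∀ C ∈ Y,
        ((coordSupport C).card : ℝ) ≤ 3 / 2 * (3 / 2) ^ t → ∃ i, T t i ∈ isolatingSets Y C)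
    (n : ℕ) : ∀ (t : ℕ) (R : Finset (Fin m)), M.Spanning (R : Set (Fin m)) →
      HasGirthAtLeast (X.supportedIn R) ((3 / 2) ^ t) →
      M.Spanning (sieveOutput M.indepOracle T n t R : Set (Fin m)) ∧
        HasGirthAtLeast (X.supportedIn (sieveOutput M.indepOracle T n t R))
          ((3 / 2) ^ (t + n)) := by
  induction n with
  | zero => exact fun t R hR hg => ⟨hR, hg⟩
  | succ n ih =>
    intro t R hR hg
    have h := ih (t + 1) _ (spanning_survivors hE (T t) hR) (by
      rw [pow_succ']
      exact hasGirthAtLeast_survivors hMX (hT t _ (hX.supportedIn R) hg))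
    rwa [show t + 1 + n = t + (n + 1) by omega] at h

theorem isBase_sieveOutput {M : Matroid (Fin m)} (hE : M.E = Set.univ) (hM : M.IsCographic)
    {T : ℕ → Fin N → Finset (Fin m)}
    (hT : ∀ t, ∀ Y : Submodule (ZMod 2) (Fin m → ZMod 2), Y.HereditarilyTwoCovered →
      HasGirthAtLeast Y ((3 / 2) ^ t) → ∀ C ∈ Y,
        ((coordSupport C).card : ℝ) ≤ 3 / 2 * (3 / 2) ^ t → ∃ i, T t i ∈ isolatingSets Y C)
    {n : ℕ} (hn : (m : ℝ) < (3 / 2) ^ n) :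
    M.IsBase (sieveOutput M.indepOracle T n 0 Finset.univ : Set (Fin m)) := by
  obtain ⟨X, hX, hMX⟩ := hM.exists_indep_iff hE
  obtain ⟨hspan, hg⟩ := sieveOutput_spec hE hX hMX hT n 0 Finset.univ
    (by rw [Finset.coe_univ, ← hE]; exact M.ground_spanning)
    (fun D _ hD => by
      obtain ⟨e, he⟩ := Function.ne_iff.1 hD
      rw [pow_zero]
      exact_mod_cast Finset.card_pos.2 ⟨e, mem_coordSupport.2 he⟩)
  -- A nonzero cut in the output would need more than `m` elements.
  refine Matroid.Indep.isBase_of_spanning ((hMX _).2 ((Submodule.eq_bot_iff _).2 ?_)) hspan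
  intro D hD
  by_contra hD0
  have h1 := hg D hD hD0
  have h2 : ((coordSupport D).card : ℝ) ≤ m := by
    exact_mod_cast (Finset.card_le_univ _).trans (by simp)
  rw [zero_add] at h1
  linarith

end ParallelDecisionTree

/-! ### Round and query bounds; conclusion -/

open ParallelDecisionTree in
/-- A deterministic algorithm that finds a basis of every cographic matroid on `m` elements. -/
theorem exists_cographic_basis_algorithm {m : ℕ} (hm : 2 ≤ m) :
    ∃ A : ParallelDecisionTree m, (A.rounds : ℝ) ≤ 4 / Real.log 2 * Real.log m ∧
      A.queriesPerRound ≤ m ^ 90 ∧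
      ∀ M : Matroid (Fin m), M.E = Set.univ → M.IsCographic → A.basisProb M = 1 := by
  have hfam : ∀ t : ℕ, ∃ T : Fin (m ^ 88) → Finset (Fin m),
      ∀ Y : Submodule (ZMod 2) (Fin m → ZMod 2), Y.HereditarilyTwoCovered →
        HasGirthAtLeast Y ((3 / 2) ^ t) → ∀ C ∈ Y,
          ((coordSupport C).card : ℝ) ≤ 3 / 2 * (3 / 2) ^ t → ∃ i, T i ∈ isolatingSets Y C := by
    intro t
    have h := exists_isolating_family (α := Fin m) (by simpa using hm)
      (γ := (3 / 2) ^ t) (by positivity)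
    rwa [Fintype.card_fin] at h
  choose T hT using hfam
  have hlog1 : 1 ≤ Nat.log 2 m := Nat.log_pos one_lt_two hm
  -- Two rounds multiply the girth bound by 9/4 ≥ 2, so this many push it past `m`; the additive
  -- term is absorbed since `Nat.log 2 m` is at least 1.
  refine ⟨sieve T (2 * (Nat.log 2 m + 1)) 0 Finset.univ, ?_, ?_, fun M hE hM => ?_⟩
  · have h1 : ((sieve T (2 * (Nat.log 2 m + 1)) 0 Finset.univ).rounds : ℝ) ≤
        4 * (Nat.log 2 m : ℝ) := by
      exact_mod_cast (rounds_sieve_le T _ 0 Finset.univ).trans (by omega)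
    have h2 : (Nat.log 2 m : ℝ) * Real.log 2 ≤ Real.log m := by
      rw [← Real.log_pow]
      exact Real.log_le_log (by positivity) (by exact_mod_cast Nat.pow_log_le_self 2 (by omega))
    have h3 : 0 < Real.log 2 := Real.log_pos one_lt_two
    rw [div_mul_eq_mul_div, le_div_iff₀ h3]
    nlinarith
  · refine (queriesPerRound_sieve_le T _ 0 Finset.univ).trans ?_
    calc m ^ 88 * (m * 2) ≤ m ^ 88 * (m * m) := by gcongr
      _ = m ^ 90 := by ring
  · refine basisProb_eq_one (outputDist_sieve _ _ _ _ _) (isBase_sieveOutput hE hM hT ?_)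
    have h1 : (m : ℝ) < 2 ^ (Nat.log 2 m + 1) := by
      exact_mod_cast Nat.lt_pow_succ_log_self one_lt_two m
    refine h1.trans_le ?_
    rw [pow_mul]
    gcongr
    norm_num

theorem mainTheorem5 :
    ∃ C : ℝ, ∀ c : ℕ, ∃ (k : ℕ) (alg : (m : ℕ) → ParallelDecisionTree m),
      ∀ m : ℕ, 2 ≤ m →
        ((alg m).rounds : ℝ) ≤ C * Real.log m ∧
        (alg m).queriesPerRound ≤ m ^ k ∧
        ∀ M : Matroid (Fin m), M.E = Set.univ → M.IsCographic →
          1 - 1 / (m : ℝ) ^ c ≤ (alg m).basisProb M := by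
  have hex : ∀ m : ℕ, ∃ A : ParallelDecisionTree m, 2 ≤ m →
      (A.rounds : ℝ) ≤ 4 / Real.log 2 * Real.log m ∧ A.queriesPerRound ≤ m ^ 90 ∧
      ∀ M : Matroid (Fin m), M.E = Set.univ → M.IsCographic → A.basisProb M = 1 := by
    intro m
    by_cases hm : 2 ≤ m
    · obtain ⟨A, hA⟩ := exists_cographic_basis_algorithm hm
      exact ⟨A, fun _ => hA⟩
    · exact ⟨ParallelDecisionTree.leaf ∅, fun h => absurd h hm⟩
  choose alg halg using hex
  -- Success is certain, so one exponent and one family serve every `c`.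
  refine ⟨4 / Real.log 2, fun c => ⟨90, alg, fun m hm => ?_⟩⟩
  obtain ⟨hr, hq, hb⟩ := halg m hm
  refine ⟨hr, hq, fun M hE hM => ?_⟩
  rw [hb M hE hM]
  have : (0 : ℝ) ≤ 1 / (m : ℝ) ^ c := by positivity
  linarith
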